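/- Let $A$ be a unital $C^*$-algebra with unitary group $U(A)$ (norm topology), and let $U_A$ be the connected component of $1$ in $U(A)$. For a closed two-sided ideal $I\subseteq A$, let $U_I$ be the connected component of $1$ in $\{u\in U(A) : u-1\in I\}$, let $CU_I$ be the closure of the commutator subgroup of $U_I$, and let $$N_I=\{u\in U_A : uvu^{-1}v^{-1}\in I+\mathbb{C}1 \text{ for all } v\in U_A\}.$$ Call a closed two-sided ideal $I$ perfect if $I=\mathrm{Id}([I,I])$, where $[I,I]$ is the linear span of $\{xy-yx : x,y\in I\}$ and $\mathrm{Id}(S)$ denotes the closed two-sided ideal of $A$ generated by $S$. Theorem. The set of all closed normal subgroups of $U_A$ equals the disjoint union $$\bigsqcup_{I\subseteq A \text{ perfect ideal}} \{H\le U_A \text{ closed subgroup} : CU_I\subseteq H\subseteq N_I\}.$$ That is, for every closed normal subgroup $H$ of $U_A$ there is exactly one perfect ideal $I$ of $A$ with $CU_I\subseteq H\subseteq N_I$; and conversely, every closed subgroup $H$ of $U_A$ with $CU_I\subseteq H\subseteq N_I$ for some perfect ideal $I$ is normal in $U_A$. -/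

import Mathlib

namespace CStarUnitary

/-- `[S, T]`: the linear span of the commutators `x * y - y * x` with `x ∈ S`, `y ∈ T`. -/
noncomputable def commutatorSpan {A : Type*} [CStarAlgebra A] (S T : Set A) : Submodule ℂ A :=
  Submodule.span ℂ {z | ∃ x ∈ S, ∃ y ∈ T, z = x * y - y * x}

/-- `Id(S)`: the smallest closed two-sided ideal containing `S`. -/
noncomputable def closedIdeal {A : Type*} [CStarAlgebra A] (S : Set A) : TwoSidedIdeal A :=
  sInf {J : TwoSidedIdeal A | IsClosed (J : Set A) ∧ S ⊆ (J : Set A)}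

/-- A closed two-sided ideal `I` is perfect if `I = Id([I, I])`. -/
noncomputable def IsPerfectIdeal {A : Type*} [CStarAlgebra A] (I : TwoSidedIdeal A) : Prop :=
  IsClosed (I : Set A) ∧ I = closedIdeal (commutatorSpan (I : Set A) (I : Set A) : Set A)

/-- `U_A`: the connected component of `1` in the unitary group `U(A)` with the norm topology. -/
noncomputable abbrev UA (A : Type*) [CStarAlgebra A] : Subgroup (unitary A) :=
  Subgroup.connectedComponentOfOne (unitary A)

/-- `U(I)`: the group of unitaries `u` of `A` with `u - 1 ∈ I`. -/
noncomputable def unitaryOfIdeal {A : Type*} [CStarAlgebra A] (I : TwoSidedIdeal A) :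
    Subgroup (unitary A) where
  carrier := {u | (u : A) - 1 ∈ I}
  one_mem' := by simp [I.zero_mem]
  mul_mem' := by
    intro u v hu hv
    have h : ((u * v : unitary A) : A) - 1 = ((u : A) - 1) * (v : A) + ((v : A) - 1) := by
      rw [Submonoid.coe_mul]; noncomm_ring
    rw [Set.mem_ofPred_eq, h]
    exact I.add_mem (I.mul_mem_right _ _ hu) hv
  inv_mem' := by
    intro u hu
    have h : ((u⁻¹ : unitary A) : A) - 1 = -(((u⁻¹ : unitary A) : A) * ((u : A) - 1)) := by
      have h1 : ((u⁻¹ : unitary A) : A) * (u : A) = 1 := by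
        rw [← Submonoid.coe_mul, inv_mul_cancel, Submonoid.coe_one]
      rw [mul_sub, h1, mul_one, neg_sub]
    rw [Set.mem_ofPred_eq, h]
    exact I.neg_mem (I.mul_mem_left _ _ hu)

/-- `U_I` as a subgroup of `U(A)`: the connected component of `1` in `U(I)`. -/
noncomputable def componentOfIdeal {A : Type*} [CStarAlgebra A] (I : TwoSidedIdeal A) :
    Subgroup (unitary A) :=
  (Subgroup.connectedComponentOfOne (unitaryOfIdeal I)).map (unitaryOfIdeal I).subtype

/-- `U_I` is contained in `U_A`. -/
theorem componentOfIdeal_le {A : Type*} [CStarAlgebra A] (I : TwoSidedIdeal A) :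
    componentOfIdeal I ≤ UA A := by
  rintro _ ⟨u, hu, rfl⟩
  have hc : Continuous (fun w : unitaryOfIdeal I => (w : unitary A)) := continuous_subtype_val
  exact hc.image_connectedComponent_subset 1 ⟨u, hu, rfl⟩

/-- `U_I` as a subgroup of `U_A`; no elements are lost, by `componentOfIdeal_le`. -/
noncomputable def UI {A : Type*} [CStarAlgebra A] (I : TwoSidedIdeal A) : Subgroup (UA A) :=
  (componentOfIdeal I).subgroupOf (UA A)

/-- `CU_I`: the closure of the commutator subgroup of `U_I`. -/
noncomputable def CUI {A : Type*} [CStarAlgebra A] (I : TwoSidedIdeal A) : Subgroup (UA A) :=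
  (⁅UI I, UI I⁆ : Subgroup (UA A)).topologicalClosure

/-- `I + ℂ 1`, the unitization of `I` inside `A`. -/
noncomputable def unitizationIn {A : Type*} [CStarAlgebra A] (I : TwoSidedIdeal A) : Set A :=
  {a | ∃ x ∈ I, ∃ c : ℂ, a = x + algebraMap ℂ A c}

/-- `N_I`: the `u ∈ U_A` such that `u v u⁻¹ v⁻¹ ∈ I + ℂ 1` for all `v ∈ U_A`. -/
noncomputable def NI {A : Type*} [CStarAlgebra A] (I : TwoSidedIdeal A) : Set (UA A) :=
  {u | ∀ v : UA A, ((u * v * u⁻¹ * v⁻¹ : UA A) : A) ∈ unitizationIn I}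

/-- The closed subgroups `H` of `U_A` with `CU_I ≤ H ≤ N_I`. -/
noncomputable def closedSubgroupsBetween {A : Type*} [CStarAlgebra A] (I : TwoSidedIdeal A) :
    Set (Subgroup (UA A)) :=
  {H | IsClosed (H : Set (UA A)) ∧ CUI I ≤ H ∧ (H : Set (UA A)) ⊆ NI I}

end CStarUnitary

/-!
A closed subgroup `H` of `U_A` has a Lie algebra: the selfadjoint `h` such that `exp (i t h) ∈ H`
for all real `t`. By the Lie product formula (`tendsto_expUA_mul_pow`) it is a closed real subspace;
`complexLieAlgebra H` is its complexification, a closed complex subspace of `A`. The product formula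
also gives two exchange principles. If all commutators of `u` with `exp (i t h)` lie in `H`, then
`u h u⋆ - h` belongs to the Lie algebra (`conj_sub_mem_lieAlgebra`). If `H` is normal and `h - k`
belongs to the Lie algebra, then `exp (i h)` and `exp (i k)` agree modulo `H`
(`expUA_mul_inv_mem`). Since `U_A` and `U_I` are generated by exponentials, questions about
commutators of unitaries become questions about additive commutators.

*The ideal of a closed normal subgroup.* Let `L` be the closed span of the elements `u a u⋆ - a`
with `u ∈ H`. It is a Lie ideal contained in the complexified Lie algebra of `H`. Let `J` be the
closed ideal generated by `[L, L]`. An algebraic argument gives `[J, A] ⊆ L`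
(`commutator_mem_of_mem_closedIdeal`), whence `[J, J]` lies in the Lie algebra and `CU_J ⊆ H`
(`CUI_le`). Modulo `J` the Lie ideal `L` is commutative; closed ideals are semiprime, so a lemma of
Herstein (`commutator_mem_of_commutator_commutator_mem`) shows first that `L`, then that `H`, is
central modulo `J`. Hence `H ⊆ N_J`; moreover `L ⊆ J`, which makes `J` perfect.

*Uniqueness.* If `CU_I ⊆ H ⊆ N_J`, differentiating one-parameter groups shows that `[I, I]` is
central modulo `J`, which forces `[I, I] ⊆ J` and so `I ⊆ J` when `I` is perfect.

*Normality.* The group `N_I` consists of the unitaries in `U_A` that are central modulo `I`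
(`mem_NI_iff`), and these are already central modulo `closure [I, I]`
(`unitary_commutator_mem_closure`). As `closure [I, I]` lies in the complexified Lie algebra of
`CU_I`, the second exchange principle yields `[N_I, U_A] ⊆ CU_I`, so that every subgroup between
`CU_I` and `N_I` is normal.
-/

namespace CStarUnitary

open Filter Topology Complex selfAdjoint
open scoped ComplexStarModule commutatorElement

variable {A : Type*} [CStarAlgebra A]

/-! ### Closed ideals of a C⋆-algebra -/

/-- A two-sided ideal of `A`, as a complex subspace. -/
def idealSubmodule (I : TwoSidedIdeal A) : Submodule ℂ A where
  carrier := I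
  add_mem' := I.add_mem
  zero_mem' := I.zero_mem
  smul_mem' c x hx := by
    simpa [Algebra.smul_def] using! I.mul_mem_left (algebraMap ℂ A c) x hx

theorem mem_idealSubmodule {I : TwoSidedIdeal A} {x : A} : x ∈ idealSubmodule I ↔ x ∈ I := Iff.rfl

theorem smul_mem_ideal (I : TwoSidedIdeal A) (c : ℂ) {x : A} (hx : x ∈ I) : c • x ∈ I :=
  (idealSubmodule I).smul_mem c hx

theorem subset_closedIdeal (S : Set A) : S ⊆ (closedIdeal S : Set A) := by
  intro x hx
  exact (TwoSidedIdeal.mem_sInf A).2 fun J hJ => hJ.2 hx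

theorem closedIdeal_le {S : Set A} {J : TwoSidedIdeal A} (hJ : IsClosed (J : Set A))
    (h : S ⊆ (J : Set A)) : closedIdeal S ≤ J :=
  sInf_le ⟨hJ, h⟩

theorem isClosed_closedIdeal (S : Set A) : IsClosed (closedIdeal S : Set A) := by
  have h : (closedIdeal S : Set A) =
      ⋂ J ∈ {J : TwoSidedIdeal A | IsClosed (J : Set A) ∧ S ⊆ (J : Set A)}, (J : Set A) := by
    ext x
    simp only [closedIdeal, SetLike.mem_coe, TwoSidedIdeal.mem_sInf, Set.mem_iInter]
  rw [h]
  exact isClosed_biInter fun J hJ => hJ.1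

/-- The intersection of an ideal with its adjoint. -/
def idealInterStar (I : TwoSidedIdeal A) : NonUnitalStarSubalgebra ℂ A where
  carrier := {x | x ∈ I ∧ star x ∈ I}
  add_mem' hx hy := ⟨I.add_mem hx.1 hy.1, by rw [star_add]; exact I.add_mem hx.2 hy.2⟩
  zero_mem' := ⟨I.zero_mem, by rw [star_zero]; exact I.zero_mem⟩
  mul_mem' hx hy := ⟨I.mul_mem_left _ _ hy.1, by rw [star_mul]; exact I.mul_mem_left _ _ hx.2⟩
  smul_mem' c x hx := ⟨smul_mem_ideal I c hx.1, by
    rw [star_smul]; exact smul_mem_ideal I _ hx.2⟩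
  star_mem' hx := ⟨hx.2, by rw [star_star]; exact hx.1⟩

theorem isClosed_idealInterStar {I : TwoSidedIdeal A} (hI : IsClosed (I : Set A)) :
    IsClosed (idealInterStar I : Set A) :=
  hI.inter (hI.preimage continuous_star)

/-- If `x⋆ x` lies in a closed ideal `I`, then `x` is approximated by elements `x e` with `e ∈ I`;
the approximate units `e = x⋆ x (x⋆ x + ε)⁻¹` do it. -/
theorem exists_mul_approx {I : TwoSidedIdeal A} (hI : IsClosed (I : Set A)) {x : A}
    (hx : star x * x ∈ I) {δ : ℝ} (hδ : 0 < δ) : ∃ e ∈ I, ‖x - x * e‖ ≤ δ := by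
  set s := star x * x with hs
  have hsa : IsSelfAdjoint s := IsSelfAdjoint.star_mul_self x
  have hspec : ∀ t ∈ spectrum ℝ s, 0 ≤ t := fun t ht => spectrum_star_mul_self_nonneg t ht
  set ε := δ ^ 2 with hε
  have hε0 : 0 < ε := by positivity
  let f : ℝ → ℝ := fun t => |t| / (|t| + ε)
  let g : ℝ → ℝ := fun t => 1 - f t
  have hfc : Continuous f := by
    refine Continuous.div (by fun_prop) (by fun_prop) fun t => ?_
    positivity
  have hgc : Continuous g := continuous_const.sub hfc
  have : IsClosed (idealInterStar I : Set A) := isClosed_idealInterStar hI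
  have hmem : cfcₙ f s ∈ idealInterStar I :=
    cfcₙ_mem (𝕜 := ℝ) (𝕜' := ℂ) f (show s ∈ idealInterStar I from ⟨hx, by
      rw [hsa.star_eq]; exact hx⟩)
  refine ⟨cfcₙ f s, hmem.1, ?_⟩
  have hf0 : f 0 = 0 := by simp [f]
  rw [cfcₙ_eq_cfc hfc.continuousOn hf0]
  have h1 : x - x * cfc f s = x * cfc g s := by
    have : cfc g s = 1 - cfc f s := by
      rw [cfc_sub (fun _ => 1) f s (by fun_prop) hfc.continuousOn, cfc_const_one ℝ s]
    rw [this, mul_sub, mul_one]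
  have hgsa : star (cfc g s) = cfc g s := (cfc_predicate g s).star_eq
  have h2 : star (x * cfc g s) * (x * cfc g s) = cfc (fun t => g t * t * g t) s := by
    rw [cfc_mul (fun t => g t * t) g s (hgc.mul continuous_id).continuousOn hgc.continuousOn,
      cfc_mul g (fun t => t) s hgc.continuousOn continuous_id.continuousOn, cfc_id' ℝ s,
      star_mul, hgsa, hs]
    simp only [mul_assoc]
  have h3 : ‖cfc (fun t => g t * t * g t) s‖ ≤ ε := by
    refine norm_cfc_le hε0.le fun t ht => ?_
    have ht0 := hspec t ht
    have hg : g t = ε / (t + ε) := by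
      simp only [g, f, abs_of_nonneg ht0]
      field_simp
      ring
    rw [hg, Real.norm_of_nonneg (by positivity)]
    have hA : ε / (t + ε) * t * (ε / (t + ε)) = ε * ((ε / (t + ε)) * (t / (t + ε))) := by ring
    rw [hA]
    have hB : ε / (t + ε) ≤ 1 := (div_le_one (by positivity)).2 (by linarith)
    have hC : t / (t + ε) ≤ 1 := (div_le_one (by positivity)).2 (by linarith)
    have hD : 0 ≤ t / (t + ε) := by positivity
    have := mul_le_one₀ hB hD hC
    nlinarith
  rw [h1]
  have h4 : ‖x * cfc g s‖ * ‖x * cfc g s‖ ≤ δ * δ := by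
    rw [← CStarRing.norm_star_mul_self, h2]
    exact h3.trans (by rw [hε]; nlinarith)
  exact abs_le_of_sq_le_sq' (by nlinarith) hδ.le |>.2

theorem mem_of_approx {S : Set A} (hS : IsClosed S) {x : A}
    (h : ∀ δ : ℝ, 0 < δ → ∃ y ∈ S, ‖x - y‖ ≤ δ) : x ∈ S := by
  rw [← hS.closure_eq, Metric.mem_closure_iff]
  intro ε hε
  obtain ⟨y, hy, hxy⟩ := h (ε / 2) (by positivity)
  exact ⟨y, hy, by rw [dist_eq_norm]; linarith⟩

theorem mem_of_star_mul_self_mem {I : TwoSidedIdeal A} (hI : IsClosed (I : Set A)) {x : A}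
    (hx : star x * x ∈ I) : x ∈ I := by
  refine mem_of_approx hI fun δ hδ => ?_
  obtain ⟨e, he, hxe⟩ := exists_mul_approx hI hx hδ
  exact ⟨x * e, I.mul_mem_left _ _ he, hxe⟩

theorem star_mem_of_mem {I : TwoSidedIdeal A} (hI : IsClosed (I : Set A)) {x : A}
    (hx : x ∈ I) : star x ∈ I :=
  mem_of_star_mul_self_mem hI (by rw [star_star]; exact I.mul_mem_right _ _ hx)

/-- Closed ideals of a C⋆-algebra are semiprime. -/
theorem mem_of_mul_mul_mem {I : TwoSidedIdeal A} (hI : IsClosed (I : Set A)) {z : A}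
    (h : ∀ c, z * c * z ∈ I) : z ∈ I := by
  refine mem_of_star_mul_self_mem hI (mem_of_star_mul_self_mem hI ?_)
  have : star (star z * z) * (star z * z) = star z * (z * star z * z) := by
    simp [mul_assoc]
  rw [this]
  exact I.mul_mem_left _ _ (h _)

/-! ### Commutators, closed ideals and Lie ideals -/

/-- `[I, A] ⊆ closure [I, I]`: since `[x e, a] = [x, e a] + [e, a x]`, this follows by letting `e`
run through an approximate unit for `x` in `I`. -/
theorem commutator_mem_closure {I : TwoSidedIdeal A} (hI : IsClosed (I : Set A)) {x : A}
    (hx : x ∈ I) (a : A) :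
    x * a - a * x ∈ (commutatorSpan (I : Set A) (I : Set A)).topologicalClosure := by
  refine mem_of_approx (Submodule.isClosed_topologicalClosure _) fun δ hδ => ?_
  obtain ⟨e, he, hxe⟩ := exists_mul_approx hI (I.mul_mem_left (star x) x hx)
    (δ := δ / (2 * (‖a‖ + 1))) (by positivity)
  refine ⟨(x * e) * a - a * (x * e), ?_, ?_⟩
  · apply Submodule.le_topologicalClosure
    have : (x * e) * a - a * (x * e) =
        (x * (e * a) - (e * a) * x) + (e * (a * x) - (a * x) * e) := by
      noncomm_ring
    rw [this]
    exact Submodule.add_mem _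
      (Submodule.subset_span ⟨x, hx, e * a, I.mul_mem_right _ _ he, rfl⟩)
      (Submodule.subset_span ⟨e, he, a * x, I.mul_mem_left _ _ hx, rfl⟩)
  · have : x * a - a * x - (x * e * a - a * (x * e)) = (x - x * e) * a - a * (x - x * e) := by
      noncomm_ring
    rw [this]
    calc ‖(x - x * e) * a - a * (x - x * e)‖ ≤ ‖x - x * e‖ * ‖a‖ + ‖a‖ * ‖x - x * e‖ :=
          (norm_sub_le _ _).trans (add_le_add (norm_mul_le _ _) (norm_mul_le _ _))
      _ = 2 * ‖a‖ * ‖x - x * e‖ := by ring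
      _ ≤ 2 * (‖a‖ + 1) * (δ / (2 * (‖a‖ + 1))) := by gcongr; linarith
      _ = δ := by field_simp

/-- A unitary commuting with `A` modulo `I` commutes with `A` modulo `closure [I, I]`. Modulo
`closure [I, I]` one has `[u ^ (n + 1), b] = (n + 1) u ^ n [u, b]`; with `b = u ^ (-n) a` the right
side is `(n + 1) [u, a]`, while the left side stays bounded by `2 ‖a‖`. -/
theorem unitary_commutator_mem_closure {I : TwoSidedIdeal A} (hI : IsClosed (I : Set A))
    {u : unitary A} (hu : ∀ a, (u : A) * a - a * u ∈ I) (a : A) :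
    (u : A) * a - a * u ∈ (commutatorSpan (I : Set A) (I : Set A)).topologicalClosure := by
  set L := (commutatorSpan (I : Set A) (I : Set A)).topologicalClosure
  have key : ∀ (n : ℕ) (b : A), ((u : A) ^ (n + 1) * b - b * (u : A) ^ (n + 1)) -
      ((n : ℂ) + 1) • ((u : A) ^ n * ((u : A) * b - b * u)) ∈ L := by
    intro n
    induction n with
    | zero => intro b; simp
    | succ n ih =>
      intro b
      have h1 := ih (b * u)
      have h2 := commutator_mem_closure hI (I.mul_mem_left ((u : A) ^ n) _ (hu b)) (u : A)
      have h3 := L.add_mem h1 (L.smul_mem ((n : ℂ) + 1) h2)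
      convert h3 using 1
      have e1 : (u : A) * (b * u) - b * u * u = (u * b - b * u) * u := by noncomm_ring
      have e2 : (u : A) ^ (n + 1) * (u * b - b * u) = u * (u ^ n * (u * b - b * u)) := by
        rw [pow_succ']; simp only [mul_assoc]
      rw [e1, e2, ← mul_assoc ((u : A) ^ n) _ (u : A)]
      have e3 : (u : A) ^ (n + 1 + 1) * b - b * u ^ (n + 1 + 1) =
          (u : A) ^ (n + 1) * (b * u) - b * u * u ^ (n + 1)
            + u * (u ^ n * (u * b - b * u)) := by
        rw [← e2, pow_succ (u : A) (n + 1)]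
        have : (u : A) ^ (n + 1) * u = u * u ^ (n + 1) := (pow_mul_comm' _ _)
        rw [mul_assoc b, ← this]
        noncomm_ring
      rw [e3]
      push_cast
      module
  refine mem_of_approx (Submodule.isClosed_topologicalClosure _) fun δ hδ => ?_
  obtain ⟨n, hn⟩ := exists_nat_gt (2 * ‖a‖ / δ)
  set w : unitary A := u ^ n with hw
  set b : A := star (w : A) * a with hb
  have hwb : (u : A) ^ n * b = a := by
    rw [hb, ← mul_assoc, ← SubmonoidClass.coe_pow, ← hw, Unitary.mul_star_self_of_mem w.2, one_mul]
  have e1 : (u : A) ^ n * ((u : A) * b - b * u) = u * a - a * u := by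
    conv_rhs => rw [← hwb]
    have : (u : A) ^ n * u = u * u ^ n := pow_mul_comm' _ _
    rw [mul_sub, ← mul_assoc, this]
    simp only [mul_assoc]
  have hmem := key n b
  rw [e1] at hmem
  have hn0 : ((n : ℂ) + 1) ≠ 0 := by exact_mod_cast Nat.succ_ne_zero n
  set c := (u : A) ^ (n + 1) * b - b * (u : A) ^ (n + 1) with hc
  have hcn : ‖c‖ ≤ 2 * ‖a‖ := by
    have hbn : ‖b‖ = ‖a‖ := by
      rw [← hwb, ← SubmonoidClass.coe_pow, CStarRing.norm_coe_unitary_mul]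
    have h1 : ‖(u : A) ^ (n + 1) * b‖ = ‖a‖ := by
      rw [← SubmonoidClass.coe_pow, CStarRing.norm_coe_unitary_mul, hbn]
    have h2 : ‖b * (u : A) ^ (n + 1)‖ = ‖a‖ := by
      rw [← SubmonoidClass.coe_pow, CStarRing.norm_mul_coe_unitary, hbn]
    have := norm_sub_le ((u : A) ^ (n + 1) * b) (b * (u : A) ^ (n + 1))
    rw [hc]; linarith
  refine ⟨-(((n : ℂ) + 1)⁻¹ • (c - ((n : ℂ) + 1) • (u * a - a * u))),
    L.neg_mem (L.smul_mem _ hmem), ?_⟩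
  have e2 : (u : A) * a - a * u - -(((n : ℂ) + 1)⁻¹ • (c - ((n : ℂ) + 1) • (u * a - a * u))) =
      ((n : ℂ) + 1)⁻¹ • c := by
    rw [smul_sub, smul_smul, inv_mul_cancel₀ hn0, one_smul]; abel
  rw [e2, norm_smul, norm_inv]
  have e3 : ‖(n : ℂ) + 1‖ = n + 1 := by
    have : ((n : ℂ) + 1) = ((n + 1 : ℕ) : ℂ) := by push_cast; rfl
    rw [this, Complex.norm_natCast]; push_cast; rfl
  rw [e3, inv_mul_le_iff₀ (by positivity)]
  rw [div_lt_iff₀ hδ] at hn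
  nlinarith

/-- For a closed Lie ideal `L`, the closed ideal `J` generated by `[L, L]` satisfies `[J, A] ⊆ L`.
Indeed `a [x, y] b` lies in `{z | [z, A] ⊆ L}` for all `x, y ∈ L` and all `a, b`. -/
theorem commutator_mem_of_mem_closedIdeal {L : Submodule ℂ A} (hLc : IsClosed (L : Set A))
    (hL : ∀ x ∈ L, ∀ a, x * a - a * x ∈ L) {z : A}
    (hz : z ∈ closedIdeal (commutatorSpan (L : Set A) (L : Set A) : Set A)) (a : A) :
    z * a - a * z ∈ L := by
  -- the largest two-sided ideal contained in `{z | [z, A] ⊆ L}`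
  let K : TwoSidedIdeal A := TwoSidedIdeal.mk'
    {z | ∀ b c a, (b * z * c) * a - a * (b * z * c) ∈ L}
    (by intro b c a; simp)
    (by
      intro x y hx hy b c a
      have := L.add_mem (hx b c a) (hy b c a)
      convert this using 1; noncomm_ring)
    (by
      intro x hx b c a
      have := L.neg_mem (hx b c a)
      convert this using 1; noncomm_ring)
    (by
      intro x y hy b c a
      have := hy (b * x) c a
      convert this using 1; noncomm_ring)
    (by
      intro x y hx b c a
      have := hx b (y * c) a
      convert this using 1; noncomm_ring)
  have hK : ∀ z, z ∈ K ↔ ∀ b c a, (b * z * c) * a - a * (b * z * c) ∈ L := fun z =>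
    TwoSidedIdeal.mem_mk' _ _ _ _ _ _ _
  have hKc : IsClosed (K : Set A) := by
    have : (K : Set A) = ⋂ b, ⋂ c, ⋂ a, {z | (b * z * c) * a - a * (b * z * c) ∈ L} := by
      ext z
      simp only [SetLike.mem_coe, hK, Set.mem_iInter, Set.mem_ofPred_eq]
    rw [this]
    refine isClosed_iInter fun b => isClosed_iInter fun c => isClosed_iInter fun a => ?_
    exact hLc.preimage (f := fun z => (b * z * c) * a - a * (b * z * c)) (by fun_prop)
  have hle : closedIdeal (commutatorSpan (L : Set A) (L : Set A) : Set A) ≤ K := by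
    refine closedIdeal_le hKc ?_
    suffices h : commutatorSpan (L : Set A) (L : Set A) ≤ idealSubmodule K from h
    refine Submodule.span_le.2 ?_
    rintro _ ⟨x, hx, y, hy, rfl⟩
    refine (hK _).2 fun b c a => ?_
    -- `{z | [z, A] ⊆ L}` is closed under multiplication
    have mulT : ∀ p q : A, (∀ a, p * a - a * p ∈ L) → (∀ a, q * a - a * q ∈ L) →
        ∀ a, (p * q) * a - a * (p * q) ∈ L := by
      intro p q hp hq a
      have := L.add_mem (hp (q * a)) (hq (a * p))
      convert this using 1; noncomm_ring
    -- `[x, y] * c = [x, y * c] - y * [x, c]`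
    have h1 : ∀ c a, ((x * y - y * x) * c) * a - a * ((x * y - y * x) * c) ∈ L := by
      intro c a
      have p1 := hL _ (hL x hx (y * c)) a
      have p2 := mulT y (x * c - c * x) (hL y hy) (hL _ (hL x hx c)) a
      have := L.sub_mem p1 p2
      convert this using 1; noncomm_ring
    -- `b * ([x, y] * c) = [x, y] * (c * b) - [[x, y] * c, b]`
    have p1 := h1 (c * b) a
    have p2 := hL _ (h1 c b) a
    have := L.sub_mem p1 p2
    convert this using 1; noncomm_ring
  simpa using (hK z).1 (hle hz) 1 1 a

/-- A lemma of Herstein modulo a closed ideal: if `ad x` has square zero, then `ad x` is zero. -/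
theorem commutator_mem_of_commutator_commutator_mem {J : TwoSidedIdeal A}
    (hJ : IsClosed (J : Set A)) {x : A}
    (h : ∀ a, x * (x * a - a * x) - (x * a - a * x) * x ∈ J) (a : A) : x * a - a * x ∈ J := by
  -- applying `(ad x) ^ 2` to a product `p * q` leaves `2 * [x, p] * [x, q]` modulo `J`
  have h2 : ∀ p q, (x * p - p * x) * (x * q - q * x) ∈ J := by
    intro p q
    have h3 := J.sub_mem (J.sub_mem (h (p * q)) (J.mul_mem_right _ q (h p)))
      (J.mul_mem_left p _ (h q))
    have h4 := smul_mem_ideal J (2⁻¹ : ℂ) h3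
    convert h4 using 1
    have : x * (x * (p * q) - p * q * x) - (x * (p * q) - p * q * x) * x -
        (x * (x * p - p * x) - (x * p - p * x) * x) * q -
        p * (x * (x * q - q * x) - (x * q - q * x) * x) =
        (2 : ℂ) • ((x * p - p * x) * (x * q - q * x)) := by
      rw [two_smul]; noncomm_ring
    rw [this, smul_smul]; norm_num
  refine mem_of_mul_mul_mem hJ fun c => ?_
  -- `[x, c * a] = [x, c] * a + c * [x, a]`
  have h3 := J.sub_mem (h2 a (c * a)) (J.mul_mem_right _ a (h2 a c))
  convert h3 using 1; noncomm_ring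

/-- If the commutators of elements of `I` are central modulo `J`, they lie in `J`: for
`c = [x, y]`, also `[x, x y] = x c` is central modulo `J`, and commuting it with `y` gives
`c ^ 2 ∈ J`. -/
theorem commutator_mem_of_central {I J : TwoSidedIdeal A} (hJ : IsClosed (J : Set A))
    (h : ∀ x ∈ I, ∀ y ∈ I, ∀ a, (x * y - y * x) * a - a * (x * y - y * x) ∈ J)
    {x y : A} (hx : x ∈ I) (hy : y ∈ I) : x * y - y * x ∈ J := by
  set c := x * y - y * x with hc
  have h1 := h x hx (x * y) (I.mul_mem_left x y hy) y
  have h2 := J.mul_mem_left x _ (h x hx y hy y)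
  have hcc : c * c ∈ J := by
    have := J.sub_mem h1 h2
    convert this using 1; rw [hc]; noncomm_ring
  refine mem_of_mul_mul_mem hJ fun b => ?_
  have h3 := J.sub_mem (J.mul_mem_left b _ hcc) (J.neg_mem (J.mul_mem_right _ c (h x hx y hy b)))
  convert h3 using 1; rw [hc]; noncomm_ring

/-! ### Exponentials in the unitary group -/

theorem expUnitary_mem_UA (h : selfAdjoint A) : expUnitary h ∈ UA A := by
  have : expUnitary h ∈ pathComponent (1 : unitary A) := joined_one_expUnitary h
  rw [pathComponent_eq_connectedComponent] at this
  exact this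

/-- The exponential `exp (i h)` of a selfadjoint element `h`, as an element of `U_A`. -/
noncomputable def expUA (h : selfAdjoint A) : UA A := ⟨expUnitary h, expUnitary_mem_UA h⟩

theorem coe_expUA (h : selfAdjoint A) : (expUA h : A) = NormedSpace.exp (I • (h : A)) := rfl

theorem coe_expUA_smul (t : ℝ) (h : selfAdjoint A) :
    (expUA (t • h) : A) = NormedSpace.exp (t • (I • (h : A))) := by
  rw [coe_expUA, selfAdjoint.val_smul, smul_comm]

theorem continuous_expUA : Continuous (expUA : selfAdjoint A → UA A) :=
  continuous_expUnitary.subtype_mk _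

theorem expUA_zero : expUA (0 : selfAdjoint A) = 1 := Subtype.ext expUnitary_zero

theorem expUA_add_smul (s t : ℝ) (h : selfAdjoint A) :
    expUA ((s + t) • h) = expUA (s • h) * expUA (t • h) := by
  refine Subtype.ext ?_
  rw [add_smul]
  refine Commute.expUnitary_add ?_
  rw [selfAdjoint.val_smul, selfAdjoint.val_smul]
  exact ((Commute.refl (h : A)).smul_left s).smul_right t

theorem expUA_neg (h : selfAdjoint A) : expUA (-h) = (expUA h)⁻¹ := by
  refine eq_inv_of_mul_eq_one_left ?_
  have := expUA_add_smul (-1) 1 h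
  simpa [expUA_zero] using this.symm

theorem expUA_natCast_smul (n : ℕ) (h : selfAdjoint A) : expUA ((n : ℝ) • h) = expUA h ^ n := by
  induction n with
  | zero => simp [expUA_zero]
  | succ n ih => rw [Nat.cast_succ, expUA_add_smul, ih, one_smul, pow_succ]

theorem expUA_inv_smul_pow (n : ℕ) (h : selfAdjoint A) :
    expUA (((n : ℝ) + 1)⁻¹ • h) ^ (n + 1) = expUA h := by
  rw [← expUA_natCast_smul, smul_smul]
  push_cast
  rw [mul_inv_cancel₀ (by positivity), one_smul]

theorem star_coe (u : UA A) : star (u : A) = ((u⁻¹ : UA A) : A) := rfl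

theorem coe_mul_inv_cancel (u : UA A) : (u : A) * ((u⁻¹ : UA A) : A) = 1 :=
  Unitary.mul_star_self_of_mem (u : unitary A).2

theorem coe_inv_mul_cancel (u : UA A) : ((u⁻¹ : UA A) : A) * (u : A) = 1 :=
  Unitary.star_mul_self_of_mem (u : unitary A).2

/-- `U_A` is generated by the exponentials of selfadjoint elements. -/
theorem closure_range_expUA : Subgroup.closure (Set.range (expUA : selfAdjoint A → UA A)) = ⊤ := by
  refine eq_top_iff.2 fun u _ => ?_
  have hu : (u : unitary A) ∈ pathComponent (1 : unitary A) := by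
    rw [pathComponent_eq_connectedComponent]; exact u.2
  obtain ⟨l, hl⟩ := Unitary.mem_pathComponentOne_iff.1 hu
  have : u = (l.map expUA).prod := by
    refine Subtype.ext ?_
    rw [← hl, Subgroup.val_list_prod, List.map_map]
    rfl
  rw [this]
  refine Subgroup.list_prod_mem _ fun x hx => ?_
  obtain ⟨h, -, rfl⟩ := List.mem_map.1 hx
  exact Subgroup.subset_closure ⟨h, rfl⟩

/-- The selfadjoint element `u h u⋆`. -/
noncomputable def conjSelfAdjoint (u : UA A) (h : selfAdjoint A) : selfAdjoint A :=
  ⟨u * h * ((u⁻¹ : UA A) : A), by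
    rw [← star_coe]; exact IsSelfAdjoint.conjugate h.2 _⟩

theorem conjSelfAdjoint_smul (u : UA A) (t : ℝ) (h : selfAdjoint A) :
    conjSelfAdjoint u (t • h) = t • conjSelfAdjoint u h := by
  refine Subtype.ext ?_
  simp [conjSelfAdjoint]

theorem expUA_conjSelfAdjoint (u : UA A) (h : selfAdjoint A) :
    expUA (conjSelfAdjoint u h) = u * expUA h * u⁻¹ := by
  refine Subtype.ext (Subtype.ext ?_)
  let +nondep : NormedAlgebra ℚ A := .restrictScalars ℚ ℂ A
  have := NormedSpace.exp_units_conj (Unitary.toUnits (u : unitary A)) (I • (h : A))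
  simp only [Unitary.val_toUnits_apply, Unitary.val_inv_toUnits_apply] at this
  change NormedSpace.exp (I • ((u : A) * h * ((u⁻¹ : UA A) : A))) = _
  rw [← smul_mul_assoc, ← mul_smul_comm]
  exact this

/-! ### The Lie product formula -/

theorem norm_pow_sub_pow_le (u v : unitary A) (n : ℕ) :
    ‖((u ^ n : unitary A) : A) - ((v ^ n : unitary A) : A)‖ ≤ n * ‖(u : A) - v‖ := by
  induction n with
  | zero => simp
  | succ n ih =>
    have : ((u ^ (n + 1) : unitary A) : A) - ((v ^ (n + 1) : unitary A) : A) =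
        ((u ^ n : unitary A) : A) * ((u : A) - v) +
          (((u ^ n : unitary A) : A) - ((v ^ n : unitary A) : A)) * (v : A) := by
      rw [pow_succ, pow_succ, Submonoid.coe_mul, Submonoid.coe_mul]; noncomm_ring
    rw [this]
    refine (norm_add_le _ _).trans ?_
    rw [CStarRing.norm_coe_unitary_mul, CStarRing.norm_mul_coe_unitary]
    rw [Nat.cast_succ, add_mul, one_mul, add_comm]
    gcongr

theorem tendsto_expUA_mul_pow (x y : selfAdjoint A) :
    Tendsto (fun n : ℕ => (expUA (((n : ℝ) + 1)⁻¹ • x) * expUA (((n : ℝ) + 1)⁻¹ • y)) ^ (n + 1))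
      atTop (𝓝 (expUA (x + y))) := by
  rw [tendsto_subtype_rng, tendsto_subtype_rng, tendsto_iff_norm_sub_tendsto_zero]
  -- the two factors agree to first order at `t = 0`
  let f : ℝ → A := fun t =>
    NormedSpace.exp (t • (I • (x : A))) * NormedSpace.exp (t • (I • (y : A))) -
      NormedSpace.exp (t • (I • ((x + y : selfAdjoint A) : A)))
  have hf : HasDerivAt f 0 0 := by
    have h := ((hasDerivAt_exp_smul_const (I • (x : A)) (0 : ℝ)).mul
      (hasDerivAt_exp_smul_const (I • (y : A)) (0 : ℝ))).sub
      (hasDerivAt_exp_smul_const (I • ((x + y : selfAdjoint A) : A)) (0 : ℝ))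
    exact h.congr_deriv (by simp)
  have hf0 : f 0 = 0 := by simp [f]
  have hlim : Tendsto (fun n : ℕ => ((n : ℝ) + 1)⁻¹) atTop (𝓝[≠] 0) := by
    refine tendsto_nhdsWithin_iff.2 ⟨?_, Eventually.of_forall fun n => ?_⟩
    · simpa using tendsto_one_div_add_atTop_nhds_zero_nat (𝕜 := ℝ)
    · exact inv_ne_zero (by positivity)
  have h1 := (hf.tendsto_slope_zero.comp hlim).norm
  simp only [norm_zero] at h1
  refine squeeze_zero (fun _ => norm_nonneg _) (fun n => ?_) h1
  have h2 := norm_pow_sub_pow_le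
    ((expUA (((n : ℝ) + 1)⁻¹ • x) * expUA (((n : ℝ) + 1)⁻¹ • y) : UA A) : unitary A)
    (expUA (((n : ℝ) + 1)⁻¹ • (x + y)) : unitary A) (n + 1)
  have h3 : ((expUA (((n : ℝ) + 1)⁻¹ • (x + y)) : unitary A)) ^ (n + 1) = expUA (x + y) := by
    rw [← expUA_inv_smul_pow n (x + y)]; rfl
  rw [h3] at h2
  refine h2.trans (le_of_eq ?_)
  have h4 : ((expUA (((n : ℝ) + 1)⁻¹ • x) * expUA (((n : ℝ) + 1)⁻¹ • y) : UA A) : A) -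
      (expUA (((n : ℝ) + 1)⁻¹ • (x + y)) : A) = f (((n : ℝ) + 1)⁻¹) := by
    simp only [f, ← coe_expUA_smul]
    rfl
  rw [h4]
  simp only [Function.comp_apply, zero_add, hf0, sub_zero, inv_inv, norm_smul]
  rw [Real.norm_of_nonneg (by positivity)]
  push_cast
  rfl

/-! ### The Lie algebra of a closed subgroup -/

/-- The selfadjoint `h` such that the one-parameter group `exp (i t h)` lies in `H`. -/
noncomputable def lieAlgebra (H : Subgroup (UA A)) (hH : IsClosed (H : Set (UA A))) :
    Submodule ℝ (selfAdjoint A) where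
  carrier := {h | ∀ t : ℝ, expUA (t • h) ∈ H}
  zero_mem' t := by rw [smul_zero, expUA_zero]; exact H.one_mem
  add_mem' {x y} hx hy t := by
    rw [smul_add]
    refine hH.mem_of_tendsto (tendsto_expUA_mul_pow (t • x) (t • y))
      (Eventually.of_forall fun n => H.pow_mem (H.mul_mem ?_ ?_) _)
    · rw [smul_smul]; exact hx _
    · rw [smul_smul]; exact hy _
  smul_mem' c x hx t := by rw [smul_smul]; exact hx _

theorem mem_lieAlgebra {H : Subgroup (UA A)} {hH : IsClosed (H : Set (UA A))} {h : selfAdjoint A} :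
    h ∈ lieAlgebra H hH ↔ ∀ t : ℝ, expUA (t • h) ∈ H := Iff.rfl

theorem isClosed_lieAlgebra (H : Subgroup (UA A)) (hH : IsClosed (H : Set (UA A))) :
    IsClosed (lieAlgebra H hH : Set (selfAdjoint A)) := by
  have : (lieAlgebra H hH : Set (selfAdjoint A)) =
      ⋂ t : ℝ, (fun h => expUA (t • h)) ⁻¹' (H : Set (UA A)) := by
    ext h; simp [mem_lieAlgebra]
  rw [this]
  exact isClosed_iInter fun t => hH.preimage (continuous_expUA.comp (continuous_const_smul t))

/-- The complexification of the Lie algebra of `H`, inside `A`. -/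
noncomputable def complexLieAlgebra (H : Subgroup (UA A)) (hH : IsClosed (H : Set (UA A))) :
    Submodule ℂ A where
  carrier := {x | ℜ x ∈ lieAlgebra H hH ∧ ℑ x ∈ lieAlgebra H hH}
  zero_mem' := by simp
  add_mem' hx hy := by
    simp only [Set.mem_ofPred_eq, map_add]
    exact ⟨Submodule.add_mem _ hx.1 hy.1, Submodule.add_mem _ hx.2 hy.2⟩
  smul_mem' c x hx := by
    simp only [Set.mem_ofPred_eq, realPart_smul, imaginaryPart_smul]
    exact ⟨Submodule.sub_mem _ (Submodule.smul_mem _ _ hx.1) (Submodule.smul_mem _ _ hx.2),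
      Submodule.add_mem _ (Submodule.smul_mem _ _ hx.2) (Submodule.smul_mem _ _ hx.1)⟩

theorem continuous_realPart : Continuous (ℜ : A → selfAdjoint A) := by
  refine continuous_induced_rng.2 ?_
  have : (Subtype.val ∘ (ℜ : A → selfAdjoint A)) = fun x => (2⁻¹ : ℝ) • (x + star x) := by
    ext x; exact realPart_apply_coe x
  rw [this]; fun_prop

theorem continuous_imaginaryPart : Continuous (ℑ : A → selfAdjoint A) := by
  refine continuous_induced_rng.2 ?_
  have : (Subtype.val ∘ (ℑ : A → selfAdjoint A)) = fun x => -I • ((2⁻¹ : ℝ) • (x - star x)) := by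
    ext x; exact imaginaryPart_apply_coe x
  rw [this]; fun_prop

theorem isClosed_complexLieAlgebra (H : Subgroup (UA A)) (hH : IsClosed (H : Set (UA A))) :
    IsClosed (complexLieAlgebra H hH : Set A) :=
  ((isClosed_lieAlgebra H hH).preimage continuous_realPart).inter
    ((isClosed_lieAlgebra H hH).preimage continuous_imaginaryPart)

theorem coe_mem_complexLieAlgebra {H : Subgroup (UA A)} {hH : IsClosed (H : Set (UA A))}
    {h : selfAdjoint A} : (h : A) ∈ complexLieAlgebra H hH ↔ h ∈ lieAlgebra H hH := by
  change (ℜ (h : A) ∈ lieAlgebra H hH ∧ ℑ (h : A) ∈ lieAlgebra H hH) ↔ _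
  simp

theorem lieAlgebra_mono {H K : Subgroup (UA A)} {hH : IsClosed (H : Set (UA A))}
    {hK : IsClosed (K : Set (UA A))} (h : H ≤ K) : lieAlgebra H hH ≤ lieAlgebra K hK :=
  fun _ hx t => h (hx t)

theorem complexLieAlgebra_mono {H K : Subgroup (UA A)} {hH : IsClosed (H : Set (UA A))}
    {hK : IsClosed (K : Set (UA A))} (h : H ≤ K) :
    complexLieAlgebra H hH ≤ complexLieAlgebra K hK :=
  fun _ hx => ⟨lieAlgebra_mono h hx.1, lieAlgebra_mono h hx.2⟩

/-- If the commutators of `u` with `exp (i t h)` lie in `H`, then `u h u⋆ - h` lies in the Lie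
algebra of `H`. -/
theorem conj_sub_mem_lieAlgebra {H : Subgroup (UA A)} (hH : IsClosed (H : Set (UA A))) {u : UA A}
    {h : selfAdjoint A} (hu : ∀ t : ℝ, u * expUA (t • h) * u⁻¹ * (expUA (t • h))⁻¹ ∈ H) :
    conjSelfAdjoint u h - h ∈ lieAlgebra H hH := by
  intro t
  rw [smul_sub, sub_eq_add_neg]
  refine hH.mem_of_tendsto (tendsto_expUA_mul_pow _ _)
    (Eventually.of_forall fun n => H.pow_mem ?_ _)
  rw [smul_neg, expUA_neg, smul_smul, smul_smul, ← conjSelfAdjoint_smul, expUA_conjSelfAdjoint]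
  exact hu _

/-- If `h - k` lies in the Lie algebra of a closed normal subgroup, then `exp (i h)` and `exp (i k)`
agree modulo that subgroup: by the Lie product formula `exp (i h)` is the limit of
`(exp (i (h - k) / n) exp (i k / n)) ^ n`, which is congruent to `exp (i k)`. -/
theorem expUA_mul_inv_mem {H : Subgroup (UA A)} [H.Normal] (hH : IsClosed (H : Set (UA A)))
    {h k : selfAdjoint A} (hk : h - k ∈ lieAlgebra H hH) : expUA h * (expUA k)⁻¹ ∈ H := by
  have h1 := (tendsto_expUA_mul_pow (h - k) k).mul_const (expUA k)⁻¹
  rw [sub_add_cancel] at h1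
  refine hH.mem_of_tendsto h1 (Eventually.of_forall fun n => ?_)
  rw [SetLike.mem_coe, ← QuotientGroup.eq_one_iff]
  have h2 : ((expUA (((n : ℝ) + 1)⁻¹ • (h - k)) : UA A) : UA A ⧸ H) = 1 :=
    (QuotientGroup.eq_one_iff _).2 (hk _)
  rw [QuotientGroup.mk_mul, QuotientGroup.mk_pow, QuotientGroup.mk_mul, h2, one_mul,
    ← QuotientGroup.mk_pow, expUA_inv_smul_pow, ← QuotientGroup.mk_mul, mul_inv_cancel,
    QuotientGroup.mk_one]

/-! ### Derivatives of one-parameter groups -/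

theorem deriv_mem_of_sub_mem {S : Submodule ℂ A} (hS : IsClosed (S : Set A)) {f : ℝ → A} {f' : A}
    (hf : HasDerivAt f f' 0) (h : ∀ t, f t - f 0 ∈ S) : f' ∈ S := by
  refine hS.mem_of_tendsto hf.tendsto_slope_zero (Eventually.of_forall fun t => ?_)
  rw [zero_add]
  exact S.smul_of_tower_mem _ (h t)

theorem hasDerivAt_expUA (h : selfAdjoint A) :
    HasDerivAt (fun t : ℝ => (expUA (t • h) : A)) (I • (h : A)) 0 := by
  simp_rw [coe_expUA_smul]
  simpa using hasDerivAt_exp_smul_const (I • (h : A)) (0 : ℝ)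

theorem hasDerivAt_expUA_inv (h : selfAdjoint A) :
    HasDerivAt (fun t : ℝ => (((expUA (t • h))⁻¹ : UA A) : A)) (-(I • (h : A))) 0 := by
  simp_rw [← expUA_neg, ← smul_neg]
  simpa using hasDerivAt_expUA (-h)

theorem hasDerivAt_expUA_conj (h : selfAdjoint A) (x : A) :
    HasDerivAt (fun t : ℝ => (expUA (t • h) : A) * x * (((expUA (t • h))⁻¹ : UA A) : A))
      (I • (h * x - x * h)) 0 := by
  have := ((hasDerivAt_expUA h).mul_const x).mul (hasDerivAt_expUA_inv h)
  refine this.congr_deriv ?_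
  rw [zero_smul, expUA_zero]
  simp [sub_eq_add_neg]

theorem mem_of_I_smul_mem {S : Submodule ℂ A} {x : A} (h : I • x ∈ S) : x ∈ S := by
  have := S.smul_mem (-I) h
  simpa [smul_smul] using this

/-- A complex linear map sending selfadjoint elements into a subspace sends all of `A` into it. -/
theorem map_mem_of_selfAdjoint {S : Submodule ℂ A} (f : A →ₗ[ℂ] A)
    (h : ∀ k : selfAdjoint A, f k ∈ S) (x : A) : f x ∈ S := by
  rw [← realPart_add_I_smul_imaginaryPart x, map_add, map_smul]
  exact S.add_mem (h _) (S.smul_mem _ (h _))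

/-- The inner derivation `a ↦ x a - a x`. -/
noncomputable def innerDerivation (x : A) : A →ₗ[ℂ] A :=
  LinearMap.mulLeft ℂ x - LinearMap.mulRight ℂ x

/-- A closed subspace invariant under conjugation by `U_A` is a Lie ideal. -/
theorem commutator_mem_of_conj_mem {L : Submodule ℂ A} (hLc : IsClosed (L : Set A))
    (hL : ∀ v : UA A, ∀ x ∈ L, (v : A) * x * ((v⁻¹ : UA A) : A) ∈ L) {x : A} (hx : x ∈ L) (a : A) :
    x * a - a * x ∈ L := by
  refine map_mem_of_selfAdjoint (innerDerivation x) (fun k => ?_) a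
  have h1 := deriv_mem_of_sub_mem hLc (hasDerivAt_expUA_conj k x)
    (fun t => L.sub_mem (hL _ x hx) (hL _ x hx))
  have := L.neg_mem (mem_of_I_smul_mem h1)
  rwa [neg_sub] at this

/-! ### The group `N_I` -/

/-- `N_J` consists of the elements of `U_A` that are central modulo `J`. -/
theorem mem_NI_iff {J : TwoSidedIdeal A} (hJ : IsClosed (J : Set A)) {u : UA A} :
    u ∈ NI J ↔ ∀ a, (u : A) * a - a * u ∈ J := by
  constructor
  · intro hu
    have hsup : ∀ x, x ∈ unitizationIn J ↔ x ∈ idealSubmodule J ⊔ (ℂ ∙ (1 : A)) := by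
      intro x
      simp only [unitizationIn, Set.mem_ofPred_eq, Submodule.mem_sup, Submodule.mem_span_singleton,
        mem_idealSubmodule, Algebra.algebraMap_eq_smul_one]
      constructor
      · rintro ⟨y, hy, c, rfl⟩; exact ⟨y, hy, _, ⟨c, rfl⟩, rfl⟩
      · rintro ⟨y, hy, _, ⟨c, rfl⟩, rfl⟩; exact ⟨y, hy, c, rfl⟩
    have hcl : IsClosed ((idealSubmodule J ⊔ (ℂ ∙ (1 : A)) : Submodule ℂ A) : Set A) :=
      Submodule.isClosed_sup_finiteDimensional _ _ hJ
    -- for selfadjoint `h` the difference `u h u⋆ - h` is a scalar `r` modulo `J`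
    have key : ∀ h : selfAdjoint A, (u : A) * h - h * u ∈ J := by
      intro h
      have hd : HasDerivAt (fun t : ℝ => (u : A) * ((expUA (t • h) : A) * ((u⁻¹ : UA A) : A) *
          (((expUA (t • h))⁻¹ : UA A) : A))) (u * (I • (h * ((u⁻¹ : UA A) : A) -
            ((u⁻¹ : UA A) : A) * h))) 0 :=
        (hasDerivAt_expUA_conj h _).const_mul _
      have hmem : ∀ t : ℝ, (u : A) * ((expUA (t • h) : A) * ((u⁻¹ : UA A) : A) *
          (((expUA (t • h))⁻¹ : UA A) : A)) ∈ idealSubmodule J ⊔ (ℂ ∙ (1 : A)) := by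
        intro t
        have := (hsup _).1 (hu (expUA (t • h)))
        convert this using 1
        simp [mul_assoc]
      have h1 := deriv_mem_of_sub_mem hcl hd fun t => Submodule.sub_mem _ (hmem t) (hmem 0)
      rw [mul_smul_comm] at h1
      obtain ⟨x, hx, r, hr⟩ := (hsup _).2 (mem_of_I_smul_mem h1)
      have h2 : (u : A) * h * ((u⁻¹ : UA A) : A) - h - r • 1 ∈ J := by
        have : (u : A) * h * ((u⁻¹ : UA A) : A) - h - r • 1 = x := by
          rw [mul_sub, ← mul_assoc, ← mul_assoc, coe_mul_inv_cancel, one_mul,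
            Algebra.algebraMap_eq_smul_one] at hr
          rw [hr]; abel
        rwa [this]
      -- iterating, `u ^ n h u ^ (-n) - h` is `n r` modulo `J`, while it stays bounded
      have h3 : ∀ n : ℕ, ((u ^ n : UA A) : A) * h * (((u ^ n)⁻¹ : UA A) : A) - h -
          ((n : ℂ) * r) • 1 ∈ J := by
        intro n
        induction n with
        | zero => simp [J.zero_mem]
        | succ n ih =>
          have h4 := J.add_mem
            (J.mul_mem_right _ ((u⁻¹ : UA A) : A) (J.mul_mem_left (u : A) _ ih)) h2
          convert h4 using 1
          rw [pow_succ', mul_inv_rev]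
          have e : (u : A) * (((u ^ n : UA A) : A) * h * (((u ^ n)⁻¹ : UA A) : A) - h -
              ((n : ℂ) * r) • 1) * ((u⁻¹ : UA A) : A) =
              (u : A) * ((u ^ n : UA A) : A) * h * ((((u ^ n)⁻¹ : UA A) : A) * ((u⁻¹ : UA A) : A))
              - u * h * ((u⁻¹ : UA A) : A) - ((n : ℂ) * r) • 1 := by
            have : ((n : ℂ) * r) • (1 : A) = u * (((n : ℂ) * r) • 1) * ((u⁻¹ : UA A) : A) := by
              rw [mul_smul_comm, smul_mul_assoc, mul_one, coe_mul_inv_cancel]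
            conv_rhs => rw [this]
            noncomm_ring
          rw [e]
          simp only [Subgroup.coe_mul, Submonoid.coe_mul]
          push_cast
          module
      have h5 : r • (1 : A) ∈ J := by
        refine mem_of_approx hJ fun δ hδ => ?_
        obtain ⟨n, hn⟩ := exists_nat_gt (2 * ‖(h : A)‖ / δ)
        have hn0 : (0 : ℝ) < n := lt_of_le_of_lt (by positivity) hn
        have hn0' : (n : ℂ) ≠ 0 := by
          have := hn0.ne'
          exact_mod_cast this
        refine ⟨-((n : ℂ)⁻¹ • _), J.neg_mem (smul_mem_ideal J _ (h3 n)), ?_⟩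
        have e : r • (1 : A) - -((n : ℂ)⁻¹ •
            (((u ^ n : UA A) : A) * h * (((u ^ n)⁻¹ : UA A) : A) - h - ((n : ℂ) * r) • 1)) =
            (n : ℂ)⁻¹ • (((u ^ n : UA A) : A) * h * (((u ^ n)⁻¹ : UA A) : A) - h) := by
          rw [smul_sub _ _ (((n : ℂ) * r) • (1 : A)), smul_smul, ← mul_assoc,
            inv_mul_cancel₀ hn0', one_mul]
          abel
        rw [e, norm_smul, norm_inv, Complex.norm_natCast, inv_mul_le_iff₀ hn0]
        rw [div_lt_iff₀ hδ] at hn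
        have h6 := norm_sub_le (((u ^ n : UA A) : A) * h * (((u ^ n)⁻¹ : UA A) : A)) (h : A)
        rw [CStarRing.norm_mul_coe_unitary, CStarRing.norm_coe_unitary_mul] at h6
        linarith
      have h7 := J.mul_mem_right _ (u : A) (J.add_mem h2 h5)
      convert h7 using 1
      rw [sub_add_cancel, sub_mul, mul_assoc _ _ (u : A), coe_inv_mul_cancel, mul_one]
    exact map_mem_of_selfAdjoint (S := idealSubmodule J) (innerDerivation (u : A)) key
  · intro hu v
    refine ⟨((u : A) * v - v * u) * (((u⁻¹ : UA A) : A) * ((v⁻¹ : UA A) : A)),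
      J.mul_mem_right _ _ (hu v), 1, ?_⟩
    have e1 : (v : A) * u * (((u⁻¹ : UA A) : A) * ((v⁻¹ : UA A) : A)) = 1 := by
      rw [mul_assoc, ← mul_assoc (u : A), coe_mul_inv_cancel, one_mul, coe_mul_inv_cancel]
    rw [sub_mul, e1, map_one, sub_add_cancel]
    simp [mul_assoc]

/-! ### The group `U_I` and its generators -/

theorem cfcₙ_mem_ideal {I : TwoSidedIdeal A} (hI : IsClosed (I : Set A)) (f : ℂ → ℂ) {x : A}
    (hx : x ∈ I) : cfcₙ f x ∈ I := by
  have : IsClosed (idealInterStar I : Set A) := isClosed_idealInterStar hI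
  exact (cfcₙ_mem (𝕜 := ℂ) (𝕜' := ℂ) f
    (show x ∈ idealInterStar I from ⟨hx, star_mem_of_mem hI hx⟩)).1

theorem expUnitary_mem_unitaryOfIdeal {I : TwoSidedIdeal A} (hI : IsClosed (I : Set A))
    {h : selfAdjoint A} (hh : (h : A) ∈ I) : expUnitary h ∈ unitaryOfIdeal I := by
  change NormedSpace.exp (Complex.I • (h : A)) - 1 ∈ I
  have hn : IsStarNormal (h : A) := h.2.isStarNormal
  have h1 := cfcₙ_mem_ideal hI (fun z => Complex.exp (Complex.I * z) - 1) hh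
  rw [cfcₙ_eq_cfc (by fun_prop) (by simp),
    cfc_sub (fun z => Complex.exp (Complex.I * z)) (fun _ => 1) (h : A),
    cfc_const_one ℂ (h : A)] at h1
  convert h1 using 2
  rw [← CFC.exp_eq_normedSpace_exp (𝕜 := ℂ), ← cfc_comp_smul Complex.I _ (h : A)]
  simp only [← Complex.exp_eq_exp_ℂ, smul_eq_mul]

theorem argSelfAdjoint_mem_ideal {I : TwoSidedIdeal A} (hI : IsClosed (I : Set A))
    {u : unitary A} (hu : u ∈ unitaryOfIdeal I) (hu2 : ‖(u : A) - 1‖ < 2) :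
    (Unitary.argSelfAdjoint u : A) ∈ I := by
  have hslit := (Unitary.spectrum_subset_slitPlane_iff_norm_lt_two u.2).mpr hu2
  have hsub : (u : A) - 1 = cfc (fun z : ℂ => z - 1) (u : A) := by
    rw [cfc_sub (fun z : ℂ => z) (fun _ => 1) (u : A), cfc_id' ℂ (u : A), cfc_const_one ℂ (u : A)]
  have hspec : spectrum ℂ ((u : A) - 1) = (fun z : ℂ => z - 1) '' spectrum ℂ (u : A) := by
    rw [hsub, cfc_map_spectrum (fun z : ℂ => z - 1) (u : A)]
  have hc : ContinuousOn (fun z => (arg (z + 1) : ℂ)) (quasispectrum ℂ ((u : A) - 1)) := by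
    refine continuous_ofReal.comp_continuousOn (continuousOn_arg.comp (by fun_prop) fun z hz => ?_)
    rw [quasispectrum_eq_spectrum_union_zero, hspec] at hz
    rcases hz with ⟨w, hw, rfl⟩ | hz
    · simpa using hslit hw
    · rw [Set.mem_singleton_iff.1 hz, zero_add]; exact one_mem_slitPlane
  have h1 := cfcₙ_mem_ideal hI (fun z => (arg (z + 1) : ℂ)) (show (u : A) - 1 ∈ I from hu)
  rw [cfcₙ_eq_cfc hc (by simp)] at h1
  have hc' := hc.mono (spectrum_subset_quasispectrum ℂ ((u : A) - 1))
  rw [hspec] at hc'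
  rw [hsub, ← cfc_comp' (fun z => (arg (z + 1) : ℂ)) (fun z => z - 1) (u : A) hc'] at h1
  simpa using h1

theorem mem_UI_iff {I : TwoSidedIdeal A} {u : UA A} :
    u ∈ UI I ↔ ∃ w : unitaryOfIdeal I, w ∈ connectedComponent (1 : unitaryOfIdeal I) ∧
      (w : unitary A) = u := by
  rw [UI, Subgroup.mem_subgroupOf, componentOfIdeal, Subgroup.mem_map]
  rfl

theorem expUA_mem_UI {I : TwoSidedIdeal A} (hI : IsClosed (I : Set A)) {h : selfAdjoint A}
    (hh : (h : A) ∈ I) : expUA h ∈ UI I := by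
  have hmem : ∀ t : ℝ, expUnitary (t • h) ∈ unitaryOfIdeal I := fun t =>
    expUnitary_mem_unitaryOfIdeal hI (by
      rw [selfAdjoint.val_smul]; exact (idealSubmodule I).smul_of_tower_mem t hh)
  let γ : ℝ → unitaryOfIdeal I := fun t => ⟨expUnitary (t • h), hmem t⟩
  have hγ : Continuous γ := by
    refine Continuous.subtype_mk ?_ _
    exact continuous_expUnitary.comp (continuous_id.smul continuous_const)
  refine mem_UI_iff.2 ⟨γ 1, ?_, ?_⟩
  · have h0 : γ 0 = 1 := Subtype.ext (by
      change expUnitary ((0 : ℝ) • h) = 1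
      rw [zero_smul, expUnitary_zero])
    have := (isPreconnected_univ.image γ hγ.continuousOn).subset_connectedComponent
      (x := 1) ⟨0, trivial, h0⟩
    exact this ⟨1, trivial, rfl⟩
  · change expUnitary ((1 : ℝ) • h) = expUnitary h
    rw [one_smul]

/-- `U_I` is generated by the exponentials of the selfadjoint elements of `I`: in `U(I)` these
generate an open, hence closed, subgroup, since logarithms of unitaries near `1` lie in `I`. -/
theorem UI_eq_closure {I : TwoSidedIdeal A} (hI : IsClosed (I : Set A)) :
    UI I = Subgroup.closure (expUA '' {h : selfAdjoint A | (h : A) ∈ I}) := by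
  apply le_antisymm
  · let S : Subgroup (unitaryOfIdeal I) := Subgroup.closure
      {w | ∃ h : selfAdjoint A, (h : A) ∈ I ∧ (w : unitary A) = expUnitary h}
    have hopen : IsOpen (S : Set (unitaryOfIdeal I)) := by
      refine S.isOpen_of_mem_nhds (g := 1) (mem_of_superset (Metric.ball_mem_nhds 1 two_pos) ?_)
      intro w hw
      have hw2 : ‖((w : unitary A) : A) - 1‖ < 2 := by
        rw [Metric.mem_ball, Subtype.dist_eq, Subtype.dist_eq, dist_eq_norm] at hw
        exact hw
      exact Subgroup.subset_closure ⟨Unitary.argSelfAdjoint (w : unitary A),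
        argSelfAdjoint_mem_ideal hI w.2 hw2, (expUnitary_argSelfAdjoint hw2).symm⟩
    have hle : connectedComponent (1 : unitaryOfIdeal I) ⊆ S :=
      IsClopen.connectedComponent_subset ⟨S.isClosed_of_isOpen hopen, hopen⟩ S.one_mem
    intro u hu
    obtain ⟨w, hw, hwu⟩ := mem_UI_iff.1 hu
    have hS : S.map (unitaryOfIdeal I).subtype ≤ (Subgroup.closure
        (expUA '' {h : selfAdjoint A | (h : A) ∈ I})).map (UA A).subtype := by
      rw [MonoidHom.map_closure, Subgroup.closure_le]
      rintro _ ⟨w, ⟨h, hh, hw⟩, rfl⟩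
      exact ⟨expUA h, Subgroup.subset_closure ⟨h, hh, rfl⟩, hw.symm⟩
    obtain ⟨v, hv, hvw⟩ := hS ⟨w, hle hw, hwu⟩
    rwa [← Subtype.ext hvw]
  · rw [Subgroup.closure_le]
    rintro _ ⟨h, hh, rfl⟩
    exact expUA_mem_UI hI hh

theorem UI_normal {I : TwoSidedIdeal A} (hI : IsClosed (I : Set A)) : (UI I).Normal := by
  refine ⟨fun n hn g => ?_⟩
  suffices h : UI I ≤ (UI I).comap (MulAut.conj g).toMonoidHom from h hn
  conv_lhs => rw [UI_eq_closure hI]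
  rw [Subgroup.closure_le]
  rintro _ ⟨h, hh, rfl⟩
  change g * expUA h * g⁻¹ ∈ UI I
  rw [← expUA_conjSelfAdjoint]
  exact expUA_mem_UI hI (I.mul_mem_right _ _ (I.mul_mem_left _ _ hh))

theorem CUI_normal {I : TwoSidedIdeal A} (hI : IsClosed (I : Set A)) : (CUI I).Normal := by
  have := UI_normal hI
  exact Subgroup.is_normal_topologicalClosure _

theorem isClosed_CUI (I : TwoSidedIdeal A) : IsClosed (CUI I : Set (UA A)) :=
  Subgroup.isClosed_topologicalClosure _

/-! ### `CU_I` and its Lie algebra -/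

/-- `[I, I]` lies in the complexified Lie algebra of `CU_I`. -/
theorem commutator_mem_complexLieAlgebra_CUI {I : TwoSidedIdeal A} (hI : IsClosed (I : Set A))
    {x y : A} (hx : x ∈ I) (hy : y ∈ I) :
    x * y - y * x ∈ complexLieAlgebra (CUI I) (isClosed_CUI I) := by
  set S := complexLieAlgebra (CUI I) (isClosed_CUI I)
  have hreal : ∀ x ∈ I, ((ℜ x : selfAdjoint A) : A) ∈ I := by
    intro x hx
    rw [realPart_apply_coe]
    exact (idealSubmodule I).smul_of_tower_mem (2⁻¹ : ℝ) (I.add_mem hx (star_mem_of_mem hI hx))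
  have himag : ∀ x ∈ I, ((ℑ x : selfAdjoint A) : A) ∈ I := by
    intro x hx
    rw [imaginaryPart_apply_coe]
    exact smul_mem_ideal I _ ((idealSubmodule I).smul_of_tower_mem (2⁻¹ : ℝ)
      (I.sub_mem hx (star_mem_of_mem hI hx)))
  have key : ∀ h k : selfAdjoint A, (h : A) ∈ I → (k : A) ∈ I → (h : A) * k - k * h ∈ S := by
    intro h k hh hk
    have hsm : ∀ {h : selfAdjoint A} (t : ℝ), (h : A) ∈ I → ((t • h : selfAdjoint A) : A) ∈ I :=
      fun t hh => by rw [selfAdjoint.val_smul]; exact (idealSubmodule I).smul_of_tower_mem t hh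
    refine mem_of_I_smul_mem (deriv_mem_of_sub_mem (isClosed_complexLieAlgebra _ _)
      (hasDerivAt_expUA_conj h (k : A)) fun t => ?_)
    have h1 : conjSelfAdjoint (expUA (t • h)) k - k ∈ lieAlgebra (CUI I) (isClosed_CUI I) := by
      refine conj_sub_mem_lieAlgebra _ fun s => Subgroup.le_topologicalClosure _ ?_
      exact Subgroup.commutator_mem_commutator (expUA_mem_UI hI (hsm t hh))
        (expUA_mem_UI hI (hsm s hk))
    have h2 := coe_mem_complexLieAlgebra.2 h1
    convert h2 using 1
    rw [zero_smul, expUA_zero]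
    simp [conjSelfAdjoint]
  have e : x * y - y * x = ((ℜ x : A) * ℜ y - ℜ y * ℜ x) +
      Complex.I • ((ℜ x : A) * ℑ y - ℑ y * ℜ x) +
      Complex.I • ((ℑ x : A) * ℜ y - ℜ y * ℑ x) - ((ℑ x : A) * ℑ y - ℑ y * ℑ x) := by
    conv_lhs => rw [← realPart_add_I_smul_imaginaryPart x, ← realPart_add_I_smul_imaginaryPart y]
    simp only [add_mul, mul_add, smul_mul_assoc, mul_smul_comm, smul_add, smul_smul,
      I_mul_I, smul_sub]
    module
  rw [e]
  have hxr := hreal x hx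
  have hxi := himag x hx
  have hyr := hreal y hy
  have hyi := himag y hy
  exact S.sub_mem (S.add_mem (S.add_mem (key _ _ hxr hyr) (S.smul_mem _ (key _ _ hxr hyi)))
    (S.smul_mem _ (key _ _ hxi hyr))) (key _ _ hxi hyi)

theorem closure_commutatorSpan_le_complexLieAlgebra_CUI {I : TwoSidedIdeal A}
    (hI : IsClosed (I : Set A)) : (commutatorSpan (I : Set A) (I : Set A)).topologicalClosure ≤
      complexLieAlgebra (CUI I) (isClosed_CUI I) := by
  refine Submodule.topologicalClosure_minimal _ (Submodule.span_le.2 ?_)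
    (isClosed_complexLieAlgebra _ _)
  rintro _ ⟨x, hx, y, hy, rfl⟩
  exact commutator_mem_complexLieAlgebra_CUI hI hx hy

/-- A closed normal subgroup whose complexified Lie algebra contains `[I, I]` contains `CU_I`. -/
theorem CUI_le {I : TwoSidedIdeal A} (hI : IsClosed (I : Set A)) {H : Subgroup (UA A)} [H.Normal]
    (hH : IsClosed (H : Set (UA A)))
    (h : ∀ x ∈ I, ∀ y ∈ I, x * y - y * x ∈ complexLieAlgebra H hH) : CUI I ≤ H := by
  refine Subgroup.topologicalClosure_minimal _ ?_ hH
  have key : ∀ h ∈ {h : selfAdjoint A | (h : A) ∈ I}, ∀ k ∈ {h : selfAdjoint A | (h : A) ∈ I},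
      ⁅expUA h, expUA k⁆ ∈ H := by
    intro x hx k hk
    rw [commutatorElement_def, ← expUA_conjSelfAdjoint]
    refine expUA_mul_inv_mem hH (coe_mem_complexLieAlgebra.1 ?_)
    have h1 := h _ (show (expUA x : A) - 1 ∈ I from expUnitary_mem_unitaryOfIdeal hI hx)
      ((k : A) * (((expUA x)⁻¹ : UA A) : A)) (I.mul_mem_right _ _ hk)
    convert h1 using 1
    change (expUA x : A) * k * (((expUA x)⁻¹ : UA A) : A) - k = _
    have := coe_inv_mul_cancel (expUA x)
    rw [sub_mul, mul_sub, mul_assoc (k : A), this, ← mul_assoc]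
    noncomm_ring
  rw [UI_eq_closure hI, Subgroup.commutator_le]
  intro g hg g' hg'
  rw [← QuotientGroup.eq_one_iff]
  change QuotientGroup.mk' H ⁅g, g'⁆ = 1
  rw [map_commutatorElement, commutatorElement_eq_one_iff_commute]
  induction hg, hg' using Subgroup.closure_induction₂ with
  | mem x y hx hy =>
    obtain ⟨p, hp, rfl⟩ := hx
    obtain ⟨q, hq, rfl⟩ := hy
    rw [← commutatorElement_eq_one_iff_commute, ← map_commutatorElement]
    exact (QuotientGroup.eq_one_iff _).2 (key p hp q hq)
  | one_left x hx => rw [map_one]; exact Commute.one_left _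
  | one_right x hx => rw [map_one]; exact Commute.one_right _
  | mul_left x y z _ _ _ h1 h2 => rw [map_mul]; exact h1.mul_left h2
  | mul_right x y z _ _ _ h1 h2 => rw [map_mul]; exact h1.mul_right h2
  | inv_left x y _ _ h => rw [map_inv]; exact h.inv_left
  | inv_right x y _ _ h => rw [map_inv]; exact h.inv_right

/-! ### Subgroups between `CU_I` and `N_I` -/

/-- `[N_I, U_A] ⊆ CU_I`: for `u ∈ N_I` the elements `u h u⋆` and `h` differ by an element of
`closure [I, I]`, so `exp (i u h u⋆)` and `exp (i h)` agree modulo `CU_I`. -/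
theorem commutator_NI_mem_CUI {I : TwoSidedIdeal A} (hI : IsClosed (I : Set A)) {u : UA A}
    (hu : u ∈ NI I) (v : UA A) : ⁅v, u⁆ ∈ CUI I := by
  have := CUI_normal hI
  have hu' := (mem_NI_iff hI).1 hu
  have key : ∀ h : selfAdjoint A, ⁅u, expUA h⁆ ∈ CUI I := by
    intro h
    rw [commutatorElement_def, ← expUA_conjSelfAdjoint]
    refine expUA_mul_inv_mem (isClosed_CUI I) (coe_mem_complexLieAlgebra.1
      (closure_commutatorSpan_le_complexLieAlgebra_CUI hI ?_))
    have h1 := unitary_commutator_mem_closure hI hu' ((h : A) * ((u⁻¹ : UA A) : A))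
    convert h1 using 1
    change (u : A) * h * ((u⁻¹ : UA A) : A) - h = _
    rw [mul_assoc (h : A), coe_inv_mul_cancel, mul_one, mul_assoc]
  have hv : v ∈ Subgroup.closure (Set.range (expUA : selfAdjoint A → UA A)) := by
    rw [closure_range_expUA]; trivial
  rw [← QuotientGroup.eq_one_iff]
  change QuotientGroup.mk' (CUI I) ⁅v, u⁆ = 1
  rw [map_commutatorElement, commutatorElement_eq_one_iff_commute]
  induction hv using Subgroup.closure_induction with
  | mem x hx =>
    obtain ⟨h, rfl⟩ := hx
    refine Commute.symm ?_
    rw [← commutatorElement_eq_one_iff_commute, ← map_commutatorElement]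
    exact (QuotientGroup.eq_one_iff _).2 (key h)
  | one => rw [map_one]; exact Commute.one_left _
  | mul x y _ _ h1 h2 => rw [map_mul]; exact h1.mul_left h2
  | inv x _ h => rw [map_inv]; exact h.inv_left

theorem normal_of_mem_closedSubgroupsBetween {I : TwoSidedIdeal A} (hI : IsClosed (I : Set A))
    {H : Subgroup (UA A)} (hH : H ∈ closedSubgroupsBetween I) : H.Normal := by
  refine ⟨fun n hn g => ?_⟩
  have h1 := H.mul_mem (hH.2.1 (commutator_NI_mem_CUI hI (hH.2.2 hn) g)) hn
  rwa [commutatorElement_def, inv_mul_cancel_right] at h1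

/-- If `CU_I ⊆ H ⊆ N_J` then `[I, I] ⊆ J`, so a perfect `I` lies in `J`. -/
theorem le_of_CUI_le_of_subset_NI {I J : TwoSidedIdeal A} (hI : IsPerfectIdeal I)
    (hJ : IsClosed (J : Set A)) {H : Subgroup (UA A)} (hH : IsClosed (H : Set (UA A)))
    (h1 : CUI I ≤ H) (h2 : (H : Set (UA A)) ⊆ NI J) : I ≤ J := by
  have hlie : ∀ d ∈ complexLieAlgebra H hH, ∀ a, d * a - a * d ∈ J := by
    have hsa : ∀ d ∈ lieAlgebra H hH, ∀ a, (d : A) * a - a * d ∈ J := by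
      intro d hd a
      have hder := ((hasDerivAt_expUA d).mul_const a).sub ((hasDerivAt_expUA d).const_mul a)
      have hm : ∀ t : ℝ, (expUA (t • d) : A) * a - a * expUA (t • d) ∈ idealSubmodule J :=
        fun t => (mem_NI_iff hJ).1 (h2 (hd t)) a
      have h3 := deriv_mem_of_sub_mem (S := idealSubmodule J) hJ hder
        fun t => Submodule.sub_mem _ (hm t) (hm 0)
      rw [smul_mul_assoc, mul_smul_comm, ← smul_sub] at h3
      exact mem_of_I_smul_mem h3
    intro d hd a
    have h3 := J.add_mem (hsa _ hd.1 a) (smul_mem_ideal J Complex.I (hsa _ hd.2 a))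
    convert h3 using 1
    conv_lhs => rw [← realPart_add_I_smul_imaginaryPart d]
    rw [add_mul, mul_add, smul_mul_assoc, mul_smul_comm, smul_sub]
    abel
  rw [hI.2]
  refine closedIdeal_le hJ ?_
  suffices h : commutatorSpan (I : Set A) (I : Set A) ≤ idealSubmodule J from h
  refine Submodule.span_le.2 ?_
  rintro _ ⟨x, hx, y, hy, rfl⟩
  -- elements of the complexified Lie algebra of `H ⊆ N_J` are central modulo `J`
  refine commutator_mem_of_central (I := I) hJ (fun x hx y hy a => hlie _ ?_ a) hx hy
  exact complexLieAlgebra_mono (hH := isClosed_CUI I) h1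
    (commutator_mem_complexLieAlgebra_CUI hI.1 hx hy)

/-! ### The ideal of a closed normal subgroup -/

/-- The closed complex linear span of all `u a u⋆ - a` with `u ∈ H`. -/
noncomputable def displacementSpan (H : Subgroup (UA A)) : Submodule ℂ A :=
  (Submodule.span ℂ {x | ∃ u ∈ H, ∃ a : A,
    x = (u : A) * a * ((u⁻¹ : UA A) : A) - a}).topologicalClosure

theorem isClosed_displacementSpan (H : Subgroup (UA A)) :
    IsClosed (displacementSpan H : Set A) := Submodule.isClosed_topologicalClosure _

theorem displacement_mem {H : Subgroup (UA A)} {u : UA A} (hu : u ∈ H) (a : A) :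
    (u : A) * a * ((u⁻¹ : UA A) : A) - a ∈ displacementSpan H :=
  Submodule.le_topologicalClosure _ (Submodule.subset_span ⟨u, hu, a, rfl⟩)

theorem commutator_mem_displacementSpan {H : Subgroup (UA A)} [hN : H.Normal] {x : A}
    (hx : x ∈ displacementSpan H) (a : A) : x * a - a * x ∈ displacementSpan H := by
  refine commutator_mem_of_conj_mem (isClosed_displacementSpan H) (fun v y hy => ?_) hx a
  let φ : A →ₗ[ℂ] A := LinearMap.mulRight ℂ ((v⁻¹ : UA A) : A) ∘ₗ LinearMap.mulLeft ℂ (v : A)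
  have hφ : ∀ y, φ y = (v : A) * y * ((v⁻¹ : UA A) : A) := fun y => rfl
  have hφc : Continuous φ := by
    change Continuous fun y : A => (v : A) * y * ((v⁻¹ : UA A) : A)
    fun_prop
  suffices h : displacementSpan H ≤ (displacementSpan H).comap φ from h hy
  refine Submodule.topologicalClosure_minimal _ (Submodule.span_le.2 ?_)
    ((isClosed_displacementSpan H).preimage hφc)
  rintro _ ⟨u, hu, b, rfl⟩
  have h1 := displacement_mem (hN.conj_mem u hu v) ((v : A) * b * ((v⁻¹ : UA A) : A))
  change φ _ ∈ displacementSpan H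
  convert h1 using 1
  rw [hφ]
  have e : ∀ c : A, ((v⁻¹ : UA A) : A) * ((v : A) * c) = c := fun c => by
    rw [← mul_assoc, coe_inv_mul_cancel, one_mul]
  simp only [mul_inv_rev, inv_inv, Subgroup.coe_mul, Submonoid.coe_mul, mul_sub, sub_mul,
    mul_assoc, e]

/-- For `u ∈ H` and selfadjoint `h`, the commutators of `u` with `exp (i t h)` lie in `H` by
normality, and their limits produce the one-parameter group of `u h u⋆ - h`. -/
theorem displacementSpan_le_complexLieAlgebra {H : Subgroup (UA A)} [hN : H.Normal]
    (hH : IsClosed (H : Set (UA A))) : displacementSpan H ≤ complexLieAlgebra H hH := by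
  refine Submodule.topologicalClosure_minimal _ (Submodule.span_le.2 ?_)
    (isClosed_complexLieAlgebra _ _)
  rintro _ ⟨u, hu, a, rfl⟩
  have key : ∀ k : selfAdjoint A,
      (u : A) * k * ((u⁻¹ : UA A) : A) - k ∈ complexLieAlgebra H hH := fun k =>
    coe_mem_complexLieAlgebra.2 (conj_sub_mem_lieAlgebra (u := u) hH fun t => by
      rw [mul_assoc, mul_assoc]
      refine H.mul_mem hu ?_
      rw [← mul_assoc]
      exact hN.conj_mem _ (H.inv_mem hu) _)
  exact map_mem_of_selfAdjoint
    (LinearMap.mulRight ℂ ((u⁻¹ : UA A) : A) ∘ₗ LinearMap.mulLeft ℂ (u : A) - LinearMap.id) key a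

/-- Every closed normal subgroup lies between `CU_J` and `N_J`, where `J` is the closed ideal
generated by the commutators of its displacement span. -/
theorem exists_perfect_of_normal {H : Subgroup (UA A)} [hN : H.Normal]
    (hH : IsClosed (H : Set (UA A))) :
    ∃ J : TwoSidedIdeal A, IsPerfectIdeal J ∧ H ∈ closedSubgroupsBetween J := by
  set L := displacementSpan H
  set J := closedIdeal (commutatorSpan (L : Set A) (L : Set A) : Set A) with hJdef
  have hJ : IsClosed (J : Set A) := isClosed_closedIdeal _
  have hLL : ∀ x ∈ L, ∀ y ∈ L, x * y - y * x ∈ J := fun x hx y hy =>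
    subset_closedIdeal _ (Submodule.subset_span ⟨x, hx, y, hy, rfl⟩)
  have hLie : ∀ x ∈ L, ∀ a, x * a - a * x ∈ L := fun x hx a =>
    commutator_mem_displacementSpan hx a
  -- modulo `J` the Lie ideal `L` is commutative, hence central
  have hLA : ∀ x ∈ L, ∀ a, x * a - a * x ∈ J := fun x hx =>
    commutator_mem_of_commutator_commutator_mem hJ fun a => hLL x hx _ (hLie x hx a)
  -- `[u, a] u⋆ ∈ L` is then central modulo `J`; commuting it with `u` gives `[u, [u, a]] ∈ J`
  have hHA : ∀ u ∈ H, ∀ a, (u : A) * a - a * u ∈ J := by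
    intro u hu
    refine commutator_mem_of_commutator_commutator_mem hJ fun a => ?_
    have h1 := J.neg_mem (J.mul_mem_right _ (u : A) (hLA _ (displacement_mem hu a) (u : A)))
    convert h1 using 1
    have e : (u : A) * a - a * u =
        ((u : A) * a * ((u⁻¹ : UA A) : A) - a) * u := by
      rw [sub_mul, mul_assoc _ _ (u : A), coe_inv_mul_cancel, mul_one]
    rw [e]
    noncomm_ring
  have hLJ : L ≤ idealSubmodule J := by
    refine Submodule.topologicalClosure_minimal _ (Submodule.span_le.2 ?_) hJ
    rintro _ ⟨u, hu, a, rfl⟩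
    have h1 := J.mul_mem_right _ ((u⁻¹ : UA A) : A) (hHA u hu a)
    change _ ∈ J
    convert h1 using 1
    rw [sub_mul, mul_assoc a, coe_mul_inv_cancel, mul_one]
  refine ⟨J, ⟨hJ, le_antisymm ?_ ?_⟩, hH, ?_, fun u hu => (mem_NI_iff hJ).2 (hHA u hu)⟩
  · refine closedIdeal_le (isClosed_closedIdeal _) (subset_trans ?_ (subset_closedIdeal _))
    refine Submodule.span_mono ?_
    rintro _ ⟨x, hx, y, hy, rfl⟩
    exact ⟨x, hLJ hx, y, hLJ hy, rfl⟩
  · refine closedIdeal_le hJ ?_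
    suffices h : commutatorSpan (J : Set A) (J : Set A) ≤ idealSubmodule J from h
    refine Submodule.span_le.2 ?_
    rintro _ ⟨x, hx, y, hy, rfl⟩
    exact J.sub_mem (J.mul_mem_left _ _ hy) (J.mul_mem_left _ _ hx)
  · exact CUI_le hJ hH fun x hx y _ => displacementSpan_le_complexLieAlgebra hH
      (commutator_mem_of_mem_closedIdeal (isClosed_displacementSpan H) hLie hx y)

end CStarUnitary

theorem mainTheorem1 {A : Type*} [CStarAlgebra A] :
    {H : Subgroup (CStarUnitary.UA A) | IsClosed (H : Set (CStarUnitary.UA A)) ∧ H.Normal} =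
      (⋃ I ∈ {I : TwoSidedIdeal A | CStarUnitary.IsPerfectIdeal I},
        CStarUnitary.closedSubgroupsBetween I) ∧
    Set.PairwiseDisjoint {I : TwoSidedIdeal A | CStarUnitary.IsPerfectIdeal I}
      CStarUnitary.closedSubgroupsBetween := by
  constructor
  · ext H
    simp only [Set.mem_ofPred_eq, Set.mem_iUnion]
    constructor
    · rintro ⟨hH, hN⟩
      obtain ⟨J, hJ, hmem⟩ := CStarUnitary.exists_perfect_of_normal hH
      exact ⟨J, hJ, hmem⟩
    · rintro ⟨I, hI, hmem⟩
      exact ⟨hmem.1, CStarUnitary.normal_of_mem_closedSubgroupsBetween hI.1 hmem⟩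
  · intro I hI J hJ hne
    refine Set.disjoint_left.2 fun H h1 h2 => hne (le_antisymm ?_ ?_)
    · exact CStarUnitary.le_of_CUI_le_of_subset_NI hI hJ.1 h1.1 h1.2.1 h2.2.2
    · exact CStarUnitary.le_of_CUI_le_of_subset_NI hJ hI.1 h1.1 h2.2.1 h1.2.2
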